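/- Let $L^2_\phi$ be the space of real functions that are square-integrable with respect to the standard normal distribution $\mathcal N(0,1)$, whose density is denoted by $\phi$. For $m\ge 0$ let $H_m(x)=\frac{(-1)^m}{\phi(x)}\frac{d^m}{dx^m}\phi(x)$ be the $m$-th (probabilists') Hermite polynomial and $h_m=H_m/\sqrt{m!}$, and for $g\in L^2_\phi$ let $\alpha_m[g]=\mathbb E_{Z\sim\mathcal N(0,1)}[g(Z)h_m(Z)]$. Let $g,h\in L^2_\phi$, and let $(X,Y)$ be bivariate normal with means $0$, variances $1$ and correlation $\rho\in[-1,1]$ (the degenerate cases $\rho=\pm1$ included). Then $g(X)$ and $h(Y)$ are square-integrable and $$\operatorname{Cov}[g(X),h(Y)]=\sum_{m=1}^{\infty}\alpha_m[g]\,\alpha_m[h]\,\rho^m,$$ where the series converges absolutely. -/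

import Mathlib

open MeasureTheory ProbabilityTheory

noncomputable section

namespace GaussHermite

/-- The standard normal density `φ`. -/
def stdNormalDensity (x : ℝ) : ℝ := gaussianPDFReal 0 1 x

/-- The probabilists' Hermite polynomial of order `m`, as a real function. -/
def hermiteFun (m : ℕ) (x : ℝ) : ℝ := Polynomial.aeval x (Polynomial.hermite m)

/-- Rodrigues' formula: `He_m(x) = (-1)^m / φ(x) * φ^(m)(x)`. -/
theorem hermiteFun_eq_iteratedDeriv (m : ℕ) (x : ℝ) :
    hermiteFun m x =
      (-1 : ℝ) ^ m / stdNormalDensity x * iteratedDeriv m stdNormalDensity x := by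
  have h : stdNormalDensity =
      fun y : ℝ => (√(2 * Real.pi))⁻¹ * Real.exp (-(y ^ 2 / 2)) := by
    funext y
    simp [stdNormalDensity, gaussianPDFReal, neg_div]
  have hc : (√(2 * Real.pi))⁻¹ ≠ 0 := by positivity
  rw [hermiteFun, Polynomial.hermite_eq_deriv_gaussian, h, iteratedDeriv_const_mul_field,
    iteratedDeriv_eq_iterate]
  field_simp

/-- The normalized Hermite polynomial `h_m = He_m / √(m!)`. -/
def normHermite (m : ℕ) (x : ℝ) : ℝ := 1 / √(m.factorial : ℝ) * hermiteFun m x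

/-- The `m`-th Hermite coefficient `α_m[g] = E[g(Z) h_m(Z)]`, with `Z` standard normal. -/
def hermiteCoeff (m : ℕ) (g : ℝ → ℝ) : ℝ :=
  ∫ z, g z * normHermite m z ∂(gaussianReal 0 1)

/-- `(X, Y)` is bivariate normal with means zero, variances one and correlation `ρ`
(the degenerate cases `ρ = 1` and `ρ = -1` are included). -/
structure IsStdBivariateNormal {Ω : Type*} [MeasurableSpace Ω] (X Y : Ω → ℝ) (ρ : ℝ)
    (P : Measure Ω) : Prop where
  gaussian : HasGaussianLaw (fun ω => (X ω, Y ω)) P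
  mean_fst : ∫ ω, X ω ∂P = 0
  mean_snd : ∫ ω, Y ω ∂P = 0
  variance_fst : variance X P = 1
  variance_snd : variance Y P = 1
  covariance_eq : covariance X Y P = ρ

end GaussHermite

end

/-! The functions `g ↦ g(X)` and `h ↦ h(Y)` are isometries from L²(φ) into L²(P), and the normalized
Hermite polynomials are a Hilbert basis of L²(φ). Expanding both functions under the inner product
reduces E[g(X) h(Y)] to the moments E[h_m(X) h_n(Y)], which are ρ^n if m = n and 0 otherwise. The
term of order 0 is the product of the means. These moments come from writing Y = ρX + W with W
independent of X and of variance 1 - ρ²: Stein's identity shows that averaging over W multiplies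
He_n by ρ^n (`integral_hermitePoly_affine`). Completeness holds because a function orthogonal to all
polynomials has, thanks to Gaussian tails, a Fourier transform with zero power series
(`ae_eq_zero_of_integral_mul_pow_eq_zero`). -/

open Polynomial in
/-- The Hermite polynomials form an Appell sequence. -/
theorem Polynomial.derivative_hermite_succ (n : ℕ) :
    derivative (hermite (n + 1)) = (n + 1 : ℤ[X]) * hermite n := by
  induction n with
  | zero => simp [hermite_succ]
  | succ n ih =>
    have h2 : derivative (derivative (hermite (n + 1))) = (n + 1 : ℤ[X]) * derivative (hermite n) := by
      rw [ih]; simp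
    rw [hermite_succ (n + 1), derivative_sub, derivative_mul, derivative_X, h2, ih, hermite_succ n]
    push_cast
    ring

/-! ### Polynomials under Gaussian measures and Stein's identity -/

namespace ProbabilityTheory

open scoped NNReal Polynomial

theorem integrable_eval_gaussianReal (μ : ℝ) (v : ℝ≥0) (p : ℝ[X]) :
    Integrable (fun x => p.eval x) (gaussianReal μ v) := by
  induction p using Polynomial.induction_on' with
  | add p q hp hq => simpa only [Polynomial.eval_add] using! hp.add hq
  | monomial n a =>
    simp only [Polynomial.eval_monomial]
    refine Integrable.const_mul ?_ a
    exact integrable_pow_of_mem_interior_integrableExpSet (X := id)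
      (by simp [integrableExpSet_id_gaussianReal]) n

theorem memLp_two_eval_gaussianReal (μ : ℝ) (v : ℝ≥0) (p : ℝ[X]) :
    MemLp (fun x => p.eval x) 2 (gaussianReal μ v) := by
  rw [memLp_two_iff_integrable_sq (by fun_prop)]
  exact (integrable_eval_gaussianReal μ v (p ^ 2)).congr (ae_of_all _ fun x => by simp)

theorem integrable_gaussianReal_iff {μ : ℝ} {v : ℝ≥0} (hv : v ≠ 0) {f : ℝ → ℝ} :
    Integrable f (gaussianReal μ v) ↔ Integrable (fun x => f x * gaussianPDFReal μ v x) := by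
  rw [gaussianReal_of_var_ne_zero _ hv, integrable_withDensity_iff (measurable_gaussianPDF _ _)
    (ae_of_all _ fun _ => gaussianPDF_lt_top)]
  simp [toReal_gaussianPDF]

theorem hasDerivAt_gaussianPDFReal_std (x : ℝ) :
    HasDerivAt (gaussianPDFReal 0 1) (-x * gaussianPDFReal 0 1 x) x := by
  have h : gaussianPDFReal 0 1 = fun y : ℝ => (√(2 * Real.pi))⁻¹ * Real.exp (-(y ^ 2 / 2)) := by
    funext y
    simp [gaussianPDFReal, neg_div]
  rw [h]
  have := ((((hasDerivAt_id x).pow 2).div_const 2).neg.exp).const_mul (√(2 * Real.pi))⁻¹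
  refine this.congr_deriv ?_
  simp only [id, Pi.pow_apply, Pi.neg_apply]
  push_cast
  ring

/-- Stein's identity for the standard normal distribution. -/
theorem integral_mul_eval_gaussianReal_std (p : ℝ[X]) :
    ∫ x, x * p.eval x ∂(gaussianReal 0 1) = ∫ x, p.derivative.eval x ∂(gaussianReal 0 1) := by
  have hi := fun q : ℝ[X] => integrable_eval_gaussianReal 0 1 q
  have hX := hi (.X * p)
  simp only [Polynomial.eval_mul, Polynomial.eval_X] at hX
  have key := integral_eq_zero_of_hasDerivAt_of_integrable
    (f := fun x => p.eval x * gaussianPDFReal 0 1 x)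
    (f' := fun x => (p.derivative.eval x - x * p.eval x) * gaussianPDFReal 0 1 x)
    (fun x => ((p.hasDerivAt x).mul (hasDerivAt_gaussianPDFReal_std x)).congr_deriv (by ring))
    ((integrable_gaussianReal_iff one_ne_zero).1 ((hi _).sub hX))
    ((integrable_gaussianReal_iff one_ne_zero).1 (hi p))
  have h2 : ∫ x, (p.derivative.eval x - x * p.eval x) ∂(gaussianReal 0 1) = 0 := by
    rw [integral_gaussianReal_eq_integral_smul one_ne_zero]
    simpa only [smul_eq_mul, mul_comm] using key
  rw [integral_sub (hi _) hX] at h2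
  linarith

/-- Stein's identity for a centered, possibly degenerate, normal distribution. -/
theorem integral_mul_eval_gaussianReal (v : ℝ≥0) (p : ℝ[X]) :
    ∫ x, x * p.eval x ∂(gaussianReal 0 v) = v * ∫ x, p.derivative.eval x ∂(gaussianReal 0 v) := by
  -- Scaling the standard normal also covers `v = 0`, where there is no density to integrate by
  -- parts.
  have hv : gaussianReal 0 v = (gaussianReal 0 1).map (fun x => √(v : ℝ) * x) := by
    rw [gaussianReal_map_const_mul]
    congr 1
    · simp
    · ext; simp
  have hs : √(v : ℝ) * √(v : ℝ) = v := Real.mul_self_sqrt v.2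
  have h := integral_mul_eval_gaussianReal_std (p.comp (.C √(v : ℝ) * .X))
  simp only [Polynomial.eval_comp, Polynomial.derivative_comp, Polynomial.eval_mul,
    Polynomial.eval_C, Polynomial.eval_X, Polynomial.derivative_mul, Polynomial.derivative_C,
    Polynomial.derivative_X, zero_mul, zero_add, mul_one, integral_const_mul] at h
  rw [hv, integral_map (by fun_prop) (by fun_prop), integral_map (by fun_prop) (by fun_prop)]
  simp only [mul_assoc, integral_const_mul]
  rw [h, ← mul_assoc, hs]

end ProbabilityTheory

/-! ### Hermite polynomials: orthogonality and the Ornstein-Uhlenbeck action -/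

namespace GaussHermite

open scoped NNReal Polynomial

/-- The `m`-th Hermite polynomial with real coefficients. -/
noncomputable abbrev hermitePoly (m : ℕ) : ℝ[X] := (Polynomial.hermite m).map (Int.castRingHom ℝ)

theorem hermiteFun_eq_eval (m : ℕ) (x : ℝ) : hermiteFun m x = (hermitePoly m).eval x := by
  rw [hermiteFun, Polynomial.aeval_def, Polynomial.eval_map]
  rfl

theorem hermitePoly_succ (n : ℕ) :
    hermitePoly (n + 1) = .X * hermitePoly n - (hermitePoly n).derivative := by
  simp [hermitePoly, Polynomial.hermite_succ, Polynomial.derivative_map]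

theorem derivative_hermitePoly_succ (n : ℕ) :
    (hermitePoly (n + 1)).derivative = .C (n + 1 : ℝ) * hermitePoly n := by
  rw [hermitePoly, Polynomial.derivative_map, Polynomial.derivative_hermite_succ]
  simp

/-- By Stein's identity `p ↦ X p - p'` is adjoint to differentiation, and He_n is its n-th iterate
applied to 1. Orthogonality follows, since n derivatives kill lower degrees. -/
theorem integral_hermitePoly_mul (n : ℕ) (q : ℝ[X]) :
    ∫ x, (hermitePoly n).eval x * q.eval x ∂(gaussianReal 0 1) =
      ∫ x, (Polynomial.derivative^[n] q).eval x ∂(gaussianReal 0 1) := by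
  induction n generalizing q with
  | zero => simp [hermitePoly]
  | succ n ih =>
    rw [Function.iterate_succ_apply, ← ih q.derivative, hermitePoly_succ]
    have h := integral_mul_eval_gaussianReal_std (hermitePoly n * q)
    have hi := fun q : ℝ[X] => integrable_eval_gaussianReal 0 1 q
    have h1 := hi (.X * (hermitePoly n * q))
    have h2 := hi ((hermitePoly n).derivative * q)
    have h3 := hi (hermitePoly n * q.derivative)
    simp only [Polynomial.eval_mul, Polynomial.eval_X, Polynomial.derivative_mul,
      Polynomial.eval_add, Polynomial.eval_sub, sub_mul, mul_assoc] at h h1 h2 h3 ⊢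
    rw [integral_add h2 h3] at h
    rw [integral_sub h1 h2, h]
    ring

theorem integral_hermitePoly_mul_hermitePoly (m n : ℕ) :
    ∫ x, (hermitePoly m).eval x * (hermitePoly n).eval x ∂(gaussianReal 0 1) =
      if m = n then (m.factorial : ℝ) else 0 := by
  have hlt : ∀ m n, n < m →
      ∫ x, (hermitePoly m).eval x * (hermitePoly n).eval x ∂(gaussianReal 0 1) = 0 := by
    intro m n h
    rw [integral_hermitePoly_mul, Polynomial.iterate_derivative_eq_zero]
    · simp
    · refine Polynomial.natDegree_map_le.trans_lt ?_
      rwa [Polynomial.natDegree_hermite]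
  split_ifs with h
  · subst h
    have hd : ∀ k : ℕ, Polynomial.derivative^[k] (hermitePoly k) = .C (k.factorial : ℝ) := by
      intro k
      induction k with
      | zero => simp [hermitePoly]
      | succ k ih =>
        rw [Function.iterate_succ_apply, derivative_hermitePoly_succ,
          Polynomial.iterate_derivative_C_mul, ih, ← Polynomial.C_mul, Nat.factorial_succ]
        push_cast
        rfl
    rw [integral_hermitePoly_mul, hd]
    simp
  · rcases lt_or_gt_of_ne h with h | h
    · simp_rw [mul_comm ((hermitePoly m).eval _)]
      exact hlt n m h
    · exact hlt m n h

/-- The Hermite polynomials are eigenvectors of the Ornstein-Uhlenbeck semigroup. -/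
theorem integral_hermitePoly_affine {ρ : ℝ} {v : ℝ≥0} (hv : (v : ℝ) = 1 - ρ ^ 2) (n : ℕ) (x : ℝ) :
    ∫ w, (hermitePoly n).eval (ρ * x + w) ∂(gaussianReal 0 v) =
      ρ ^ n * (hermitePoly n).eval x := by
  have hi : ∀ q : ℝ[X], Integrable (fun w => q.eval (ρ * x + w)) (gaussianReal 0 v) := fun q => by
    simpa using integrable_eval_gaussianReal 0 v (q.comp (.C (ρ * x) + .X))
  have stein : ∀ q : ℝ[X], ∫ w, w * q.eval (ρ * x + w) ∂(gaussianReal 0 v) =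
      v * ∫ w, q.derivative.eval (ρ * x + w) ∂(gaussianReal 0 v) := fun q => by
    simpa [Polynomial.derivative_comp] using
      integral_mul_eval_gaussianReal v (q.comp (.C (ρ * x) + .X))
  -- Stein's identity turns the term `w * He_n` into `v` times the derivative; the coefficient is
  -- then `v - 1 = -ρ ^ 2`.
  have hrec : ∀ n, ∫ w, (hermitePoly (n + 1)).eval (ρ * x + w) ∂(gaussianReal 0 v) =
      ρ * x * ∫ w, (hermitePoly n).eval (ρ * x + w) ∂(gaussianReal 0 v) -
        ρ ^ 2 * ∫ w, (hermitePoly n).derivative.eval (ρ * x + w) ∂(gaussianReal 0 v) := by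
    intro n
    have hw : Integrable (fun w => w * (hermitePoly n).eval (ρ * x + w)) (gaussianReal 0 v) := by
      simpa using integrable_eval_gaussianReal 0 v
        (.X * (hermitePoly n).comp (.C (ρ * x) + .X))
    have he : ∀ w, (hermitePoly (n + 1)).eval (ρ * x + w) =
        ρ * x * (hermitePoly n).eval (ρ * x + w) + w * (hermitePoly n).eval (ρ * x + w) -
          (hermitePoly n).derivative.eval (ρ * x + w) := fun w => by
      rw [hermitePoly_succ]
      simp only [Polynomial.eval_sub, Polynomial.eval_mul, Polynomial.eval_X]
      ring
    simp_rw [he]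
    rw [integral_sub (by exact ((hi _).const_mul _).add hw) (hi _),
      integral_add ((hi _).const_mul _) hw, integral_const_mul, stein, hv]
    ring
  induction n using Nat.twoStepInduction with
  | zero => simp [hermitePoly]
  | one =>
    rw [hrec]
    simp [hermitePoly]
  | more n ih0 ih1 =>
    rw [hrec, ih1, hermitePoly_succ (n + 1), derivative_hermitePoly_succ]
    simp only [Polynomial.eval_sub, Polynomial.eval_mul, Polynomial.eval_X, Polynomial.eval_C,
      integral_const_mul, ih0]
    ring

end GaussHermite

/-! ### Mixed Hermite moments of the bivariate normal law -/

namespace GaussHermite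

open scoped NNReal Polynomial

namespace IsStdBivariateNormal

variable {Ω : Type*} [MeasurableSpace Ω] {X Y : Ω → ℝ} {ρ : ℝ} {P : Measure Ω}

theorem symm (h : IsStdBivariateNormal X Y ρ P) : IsStdBivariateNormal Y X ρ P where
  gaussian := h.gaussian.map_equiv (ContinuousLinearEquiv.prodComm ℝ ℝ ℝ)
  mean_fst := h.mean_snd
  mean_snd := h.mean_fst
  variance_fst := h.variance_snd
  variance_snd := h.variance_fst
  covariance_eq := by rw [covariance_comm, h.covariance_eq]

theorem map_fst (h : IsStdBivariateNormal X Y ρ P) : P.map X = gaussianReal 0 1 := by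
  rw [h.gaussian.fst.map_eq_gaussianReal, h.mean_fst, h.variance_fst, Real.toNNReal_one]

theorem map_snd (h : IsStdBivariateNormal X Y ρ P) : P.map Y = gaussianReal 0 1 :=
  h.symm.map_fst

theorem memLp_comp_fst (h : IsStdBivariateNormal X Y ρ P) {g : ℝ → ℝ}
    (hg : MemLp g 2 (gaussianReal 0 1)) : MemLp (fun ω => g (X ω)) 2 P :=
  MemLp.comp_of_map (by rwa [h.map_fst]) h.gaussian.fst.aemeasurable

theorem memLp_comp_snd (h : IsStdBivariateNormal X Y ρ P) {g : ℝ → ℝ}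
    (hg : MemLp g 2 (gaussianReal 0 1)) : MemLp (fun ω => g (Y ω)) 2 P :=
  h.symm.memLp_comp_fst hg

variable [IsProbabilityMeasure P]

/-- The residual `Y - ρ X` is independent of `X` and normal with variance `1 - ρ ^ 2`. -/
theorem exists_residual (h : IsStdBivariateNormal X Y ρ P) :
    ∃ v : ℝ≥0, (v : ℝ) = 1 - ρ ^ 2 ∧
      P.map (fun ω => (X ω, Y ω - ρ * X ω)) = (gaussianReal 0 1).prod (gaussianReal 0 v) := by
  have hX := h.gaussian.fst.memLp_two
  have hY := h.gaussian.snd.memLp_two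
  have hρX : MemLp (fun ω => ρ * X ω) 2 P := hX.const_mul ρ
  have hgauss : HasGaussianLaw (fun ω => (X ω, Y ω - ρ * X ω)) P :=
    h.gaussian.map_fun ((ContinuousLinearMap.fst ℝ ℝ ℝ).prod
      (ContinuousLinearMap.snd ℝ ℝ ℝ - ρ • ContinuousLinearMap.fst ℝ ℝ ℝ))
  have hcov : covariance X (fun ω => Y ω - ρ * X ω) P = 0 := by
    rw [covariance_fun_sub_right hX hY hρX, covariance_const_mul_right, h.covariance_eq,
      covariance_self h.gaussian.fst.aemeasurable, h.variance_fst]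
    ring
  have hvar : variance (fun ω => Y ω - ρ * X ω) P = 1 - ρ ^ 2 := by
    rw [variance_fun_sub hY hρX, covariance_const_mul_right, covariance_comm, h.covariance_eq,
      variance_const_mul, h.variance_fst, h.variance_snd]
    ring
  have hmean : ∫ ω, (Y ω - ρ * X ω) ∂P = 0 := by
    rw [integral_sub (hY.integrable one_le_two) (hρX.integrable one_le_two),
      integral_const_mul, h.mean_fst, h.mean_snd]
    ring
  -- `toNNReal` truncates nothing: 1 - ρ² is a variance, hence nonnegative.
  refine ⟨(1 - ρ ^ 2).toNNReal, Real.coe_toNNReal _ (hvar ▸ variance_nonneg _ _), ?_⟩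
  rw [(indepFun_iff_map_prod_eq_prod_map_map hgauss.fst.aemeasurable
    hgauss.snd.aemeasurable).1 (hgauss.indepFun_of_covariance_eq_zero hcov), h.map_fst,
    hgauss.snd.map_eq_gaussianReal, hmean, hvar]

/-- By independence of the residual, Fubini integrates it out first, and He_n is an eigenvector of
that averaging. -/
theorem integral_mul_hermitePoly (h : IsStdBivariateNormal X Y ρ P) (p : ℝ[X]) (n : ℕ) :
    ∫ ω, p.eval (X ω) * (hermitePoly n).eval (Y ω) ∂P =
      ρ ^ n * ∫ x, p.eval x * (hermitePoly n).eval x ∂(gaussianReal 0 1) := by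
  obtain ⟨v, hv, hmap⟩ := h.exists_residual
  have hXm := h.gaussian.fst.aemeasurable
  have hYm := h.gaussian.snd.aemeasurable
  have hZm : AEMeasurable (fun ω => (X ω, Y ω - ρ * X ω)) P := by fun_prop
  let F : ℝ × ℝ → ℝ := fun z => p.eval z.1 * (hermitePoly n).eval (ρ * z.1 + z.2)
  have hFm : Measurable F := by fun_prop
  have hFZ : (fun ω => F (X ω, Y ω - ρ * X ω)) =
      fun ω => p.eval (X ω) * (hermitePoly n).eval (Y ω) := by
    funext ω
    simp [F]
  have hint : Integrable F ((gaussianReal 0 1).prod (gaussianReal 0 v)) := by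
    rw [← hmap, integrable_map_measure hFm.aestronglyMeasurable hZm]
    refine Integrable.congr ?_ (ae_of_all _ fun ω => (congrFun hFZ ω).symm)
    exact (h.memLp_comp_fst (memLp_two_eval_gaussianReal 0 1 p)).integrable_mul
      (h.memLp_comp_snd (memLp_two_eval_gaussianReal 0 1 (hermitePoly n)))
  rw [← hFZ, ← integral_map hZm hFm.aestronglyMeasurable, hmap, integral_prod _ hint,
    ← integral_const_mul]
  refine integral_congr_ae (ae_of_all _ fun x => ?_)
  simp only [F]
  rw [integral_const_mul, integral_hermitePoly_affine hv]
  ring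

end IsStdBivariateNormal

theorem normHermite_mul_normHermite (m n : ℕ) (x y : ℝ) :
    normHermite m x * normHermite n y =
      1 / (√(m.factorial : ℝ) * √(n.factorial : ℝ)) *
        ((hermitePoly m).eval x * (hermitePoly n).eval y) := by
  simp only [normHermite, hermiteFun_eq_eval]
  field_simp

theorem integral_normHermite_mul_normHermite (m n : ℕ) :
    ∫ x, normHermite m x * normHermite n x ∂(gaussianReal 0 1) = if m = n then 1 else 0 := by
  simp_rw [normHermite_mul_normHermite]
  rw [integral_const_mul, integral_hermitePoly_mul_hermitePoly]
  split_ifs with hmn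
  · subst hmn
    have : (m.factorial : ℝ) ≠ 0 := by positivity
    rw [Real.mul_self_sqrt (by positivity)]
    field_simp
  · simp

/-- The normalized Hermite polynomials are orthogonal under a standard bivariate normal law. -/
theorem IsStdBivariateNormal.integral_normHermite_mul {Ω : Type*} [MeasurableSpace Ω]
    {X Y : Ω → ℝ} {ρ : ℝ} {P : Measure Ω} [IsProbabilityMeasure P]
    (h : IsStdBivariateNormal X Y ρ P) (m n : ℕ) :
    ∫ ω, normHermite m (X ω) * normHermite n (Y ω) ∂P = if m = n then ρ ^ n else 0 := by
  simp_rw [normHermite_mul_normHermite]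
  have h1 := integral_normHermite_mul_normHermite m n
  simp_rw [normHermite_mul_normHermite, integral_const_mul] at h1
  rw [integral_const_mul, h.integral_mul_hermitePoly, mul_left_comm, h1, mul_ite, mul_one, mul_zero]

theorem memLp_normHermite (m : ℕ) : MemLp (normHermite m) 2 (gaussianReal 0 1) := by
  have : normHermite m = fun x => 1 / √(m.factorial : ℝ) * (hermitePoly m).eval x := by
    funext x
    rw [normHermite, hermiteFun_eq_eval]
  rw [this]
  exact (memLp_two_eval_gaussianReal 0 1 _).const_mul _

end GaussHermite

/-! ### Determinacy by Fourier transform and by moments -/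

namespace MeasureTheory

/-- An integrable real function is determined by the characteristic function of the signed measure
it is the density of. -/
theorem ae_eq_zero_of_integral_mul_cexp_eq_zero {μ : Measure ℝ} {f : ℝ → ℝ} (hf : Integrable f μ)
    (h : ∀ t : ℝ, ∫ x, (f x : ℂ) * Complex.exp (t * x * Complex.I) ∂μ = 0) : f =ᵐ[μ] 0 := by
  have hfin : ∀ {g : ℝ → ℝ}, Integrable g μ →
      IsFiniteMeasure (μ.withDensity fun x => ENNReal.ofReal (g x)) := fun hg =>
    isFiniteMeasure_withDensity_ofReal hg.2
  have hfp := hfin hf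
  have hfn := hfin hf.neg
  have hchar : ∀ {g : ℝ → ℝ}, Integrable g μ → ∀ t : ℝ,
      charFun (μ.withDensity fun x => ENNReal.ofReal (g x)) t =
        ∫ x, (max (g x) 0 : ℝ) * Complex.exp (t * x * Complex.I) ∂μ := fun {g} hg t => by
    rw [charFun_apply_real, integral_withDensity_eq_integral_toReal_smul₀
      hg.aemeasurable.ennreal_ofReal (ae_of_all _ fun _ => ENNReal.ofReal_lt_top)]
    simp only [ENNReal.toReal_ofReal', Complex.real_smul]
  have hint : ∀ {g : ℝ → ℝ}, Integrable g μ → ∀ t : ℝ,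
      Integrable (fun x => ((max (g x) 0 : ℝ) : ℂ) * Complex.exp (t * x * Complex.I)) μ :=
    fun {g} hg t => by
    refine (hg.pos_part.ofReal (𝕜 := ℂ)).mul_bdd (c := 1) (by fun_prop) (ae_of_all _ fun x => ?_)
    rw [← Complex.ofReal_mul, Complex.norm_exp_ofReal_mul_I]
  -- The positive and negative parts of `f` are densities of finite measures with equal
  -- characteristic functions.
  have heq : (μ.withDensity fun x => ENNReal.ofReal (f x)) =
      μ.withDensity fun x => ENNReal.ofReal ((-f) x) := by
    refine Measure.ext_of_charFun (funext fun t => ?_)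
    rw [hchar hf, hchar hf.neg, ← sub_eq_zero, ← integral_sub (hint hf t) (hint hf.neg t), ← h t]
    refine integral_congr_ae (ae_of_all _ fun x => ?_)
    simp only [Pi.neg_apply]
    rw [← sub_mul, ← Complex.ofReal_sub, max_zero_sub_max_neg_zero_eq_self]
  rw [withDensity_eq_iff hf.aemeasurable.ennreal_ofReal hf.neg.aemeasurable.ennreal_ofReal
    hf.lintegral_lt_top.ne] at heq
  filter_upwards [heq] with x hx
  have := congrArg ENNReal.toReal hx
  simp only [ENNReal.toReal_ofReal', Pi.neg_apply] at this
  simpa [this] using (max_zero_sub_max_neg_zero_eq_self (f x)).symm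

/-- If the exponential moments of `|f| μ` are finite and all its moments vanish, then `f = 0`. -/
theorem ae_eq_zero_of_integral_mul_pow_eq_zero {μ : Measure ℝ} {f : ℝ → ℝ}
    (hf : AEStronglyMeasurable f μ)
    (hexp : ∀ t : ℝ, Integrable (fun x => |f x| * Real.exp |t * x|) μ)
    (h : ∀ n : ℕ, ∫ x, f x * x ^ n ∂μ = 0) : f =ᵐ[μ] 0 := by
  have hfi : Integrable f μ := by
    have := hexp 0
    simp only [zero_mul, abs_zero, Real.exp_zero, mul_one] at this
    exact (integrable_norm_iff hf).1 this
  refine ae_eq_zero_of_integral_mul_cexp_eq_zero hfi fun t => ?_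
  have hbound : ∀ x : ℝ, HasSum (fun n : ℕ => |f x| * (|t * x| ^ n / n.factorial))
      (|f x| * Real.exp |t * x|) := fun x => by
    rw [Real.exp_eq_exp_ℝ]
    exact (NormedSpace.expSeries_div_hasSum_exp (𝔸 := ℝ) |t * x|).mul_left _
  -- The exponential series is integrated termwise, dominated by `|f x| * exp |t * x|`; each term is
  -- a multiple of a moment.
  have key := hasSum_integral_of_dominated_convergence (μ := μ)
    (F := fun (n : ℕ) (x : ℝ) => (f x : ℂ) * ((t * x * Complex.I) ^ n / n.factorial))
    (f := fun x => (f x : ℂ) * Complex.exp (t * x * Complex.I))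
    (fun n x => |f x| * (|t * x| ^ n / n.factorial))
    (fun n => (Complex.continuous_ofReal.comp_aestronglyMeasurable hf).mul (by fun_prop))
    (fun n => ae_of_all _ fun x => le_of_eq (by simp [abs_mul]))
    (ae_of_all _ fun x => (hbound x).summable)
    (by simpa only [(hbound _).tsum_eq] using hexp t)
    (ae_of_all _ fun x => by
      rw [Complex.exp_eq_exp_ℂ]
      exact (NormedSpace.expSeries_div_hasSum_exp (𝔸 := ℂ) _).mul_left _)
  refine key.unique ?_
  have hterm : ∀ n : ℕ, ∫ x, (f x : ℂ) * ((t * x * Complex.I) ^ n / n.factorial) ∂μ = 0 := by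
    intro n
    have : ∀ x : ℝ, (f x : ℂ) * ((t * x * Complex.I) ^ n / n.factorial) =
        (t * Complex.I) ^ n / n.factorial * ((f x * x ^ n : ℝ) : ℂ) := fun x => by
      push_cast
      ring
    simp_rw [this]
    rw [integral_const_mul, integral_complex_ofReal, h n]
    simp
  simp only [hterm]
  exact hasSum_zero

end MeasureTheory

/-! ### Completeness of the Hermite polynomials -/

namespace GaussHermite

open scoped NNReal Polynomial

/-- A square-integrable function all of whose Hermite coefficients vanish is zero. -/
theorem ae_eq_zero_of_hermiteCoeff_eq_zero {f : ℝ → ℝ} (hf : MemLp f 2 (gaussianReal 0 1))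
    (h : ∀ m, hermiteCoeff m f = 0) : f =ᵐ[gaussianReal 0 1] 0 := by
  have hint : ∀ p : ℝ[X], Integrable (fun x => f x * p.eval x) (gaussianReal 0 1) := fun p =>
    hf.integrable_mul (memLp_two_eval_gaussianReal 0 1 p)
  have hherm : ∀ m, ∫ x, f x * (hermitePoly m).eval x ∂(gaussianReal 0 1) = 0 := fun m => by
    have hm := h m
    simp only [hermiteCoeff, normHermite, hermiteFun_eq_eval, mul_left_comm (f _),
      integral_const_mul] at hm
    exact (mul_eq_zero.1 hm).resolve_left (by positivity)
  -- He_n is monic, so subtracting `p.coeff n` times it lowers the degree bound.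
  have hpoly : ∀ (n : ℕ) (p : ℝ[X]), p.natDegree < n →
      ∫ x, f x * p.eval x ∂(gaussianReal 0 1) = 0 := by
    intro n
    induction n with
    | zero => simp
    | succ n ih =>
      intro p hp
      have hsplit : ∀ x, f x * p.eval x = f x * (p - .C (p.coeff n) * hermitePoly n).eval x +
          p.coeff n * (f x * (hermitePoly n).eval x) := fun x => by
        simp only [Polynomial.eval_sub, Polynomial.eval_mul, Polynomial.eval_C]
        ring
      simp_rw [hsplit]
      rw [integral_add (hint _) ((hint _).const_mul _), integral_const_mul, hherm, mul_zero,
        add_zero]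
      have hdeg : (hermitePoly n).natDegree = n := by
        rw [(Polynomial.hermite_monic n).natDegree_map, Polynomial.natDegree_hermite]
      have hlead : (hermitePoly n).coeff n = 1 := by simp
      set q := p - .C (p.coeff n) * hermitePoly n with hq
      by_cases hq0 : q = 0
      · simp [hq0]
      refine ih q ((Polynomial.natDegree_lt_iff_degree_lt hq0).2 ?_)
      rw [Polynomial.degree_lt_iff_coeff_zero]
      intro k hk
      rcases hk.eq_or_lt with rfl | hk
      · simp [hq, -Polynomial.coeff_map, hlead]
      · rw [hq, Polynomial.coeff_sub, Polynomial.coeff_C_mul,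
          Polynomial.coeff_eq_zero_of_natDegree_lt (by omega),
          Polynomial.coeff_eq_zero_of_natDegree_lt (p := hermitePoly n) (by omega)]
        simp
  refine ae_eq_zero_of_integral_mul_pow_eq_zero hf.1 (fun t => ?_) fun n => by
    simpa using hpoly (n + 1) (.X ^ n) (by simp)
  have hexp : ∀ s : ℝ, MemLp (fun x => Real.exp (s * x)) 2 (gaussianReal 0 1) := fun s => by
    rw [memLp_two_iff_integrable_sq (by fun_prop)]
    refine (integrable_exp_mul_gaussianReal (2 * s)).congr (ae_of_all _ fun x => ?_)
    simp only [← Real.exp_nat_mul]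
    push_cast
    ring_nf
  have hdom : Integrable (fun x => |f x| * (Real.exp (t * x) + Real.exp (-t * x)))
      (gaussianReal 0 1) := hf.abs.integrable_mul ((hexp t).add (hexp (-t)))
  refine hdom.mono' (hf.1.norm.mul (by fun_prop)) (ae_of_all _ fun x => ?_)
  rw [Real.norm_of_nonneg (by positivity)]
  gcongr
  rcases abs_cases (t * x) with ⟨h1, -⟩ | ⟨h1, -⟩ <;> rw [h1] <;>
    simp only [neg_mul, le_add_iff_nonneg_left, le_add_iff_nonneg_right, Real.exp_nonneg]

end GaussHermite

/-! ### The Hilbert basis and the expansion of mixed moments -/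

namespace GaussHermite

open scoped InnerProductSpace

/-- The normalized Hermite polynomial as an element of `L²` of the standard normal law. -/
noncomputable def hermiteLp (m : ℕ) : Lp ℝ 2 (gaussianReal 0 1) := (memLp_normHermite m).toLp

theorem inner_toLp_toLp {α : Type*} [MeasurableSpace α] {μ : Measure α} {f g : α → ℝ}
    (hf : MemLp f 2 μ) (hg : MemLp g 2 μ) : ⟪hf.toLp, hg.toLp⟫_ℝ = ∫ x, f x * g x ∂μ := by
  rw [L2.inner_def]
  refine integral_congr_ae ?_
  filter_upwards [hf.coeFn_toLp, hg.coeFn_toLp] with x h1 h2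
  simp [h1, h2, mul_comm]

theorem inner_hermiteLp_toLp (m : ℕ) {g : ℝ → ℝ} (hg : MemLp g 2 (gaussianReal 0 1)) :
    ⟪hermiteLp m, hg.toLp⟫_ℝ = hermiteCoeff m g := by
  rw [real_inner_comm, hermiteLp, inner_toLp_toLp, hermiteCoeff]

theorem orthonormal_hermiteLp : Orthonormal ℝ hermiteLp := by
  rw [orthonormal_iff_ite]
  intro m n
  rw [hermiteLp, hermiteLp, inner_toLp_toLp, integral_normHermite_mul_normHermite]

theorem orthogonal_span_hermiteLp : (Submodule.span ℝ (Set.range hermiteLp))ᗮ = ⊥ := by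
  rw [Submodule.eq_bot_iff]
  intro f hf
  rw [Submodule.mem_orthogonal] at hf
  have h0 : ∀ m, hermiteCoeff m f = 0 := fun m => by
    rw [← inner_hermiteLp_toLp m (Lp.memLp f), Lp.toLp_coeFn]
    exact hf _ (Submodule.subset_span ⟨m, rfl⟩)
  exact (Lp.eq_zero_iff_ae_eq_zero).2 (ae_eq_zero_of_hermiteCoeff_eq_zero (Lp.memLp f) h0)

/-- The Hilbert basis of normalized Hermite polynomials. -/
noncomputable def hermiteBasis : HilbertBasis ℕ ℝ (Lp ℝ 2 (gaussianReal 0 1)) :=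
  HilbertBasis.mkOfOrthogonalEqBot orthonormal_hermiteLp orthogonal_span_hermiteLp

theorem hermiteBasis_hasSum {g : ℝ → ℝ} (hg : MemLp g 2 (gaussianReal 0 1)) :
    HasSum (fun m => hermiteCoeff m g • hermiteLp m) hg.toLp := by
  have := hermiteBasis.hasSum_repr hg.toLp
  simpa only [HilbertBasis.repr_apply_apply, hermiteBasis,
    HilbertBasis.coe_mkOfOrthogonalEqBot, inner_hermiteLp_toLp] using this

namespace IsStdBivariateNormal

variable {Ω : Type*} [MeasurableSpace Ω] {X Y X' Y' : Ω → ℝ} {ρ : ℝ} {P : Measure Ω}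

/-- A Gaussian law gives only a.e. measurability, while composition on L² is set up for measurable
maps; this permits passing to measurable versions. -/
theorem congr (h : IsStdBivariateNormal X Y ρ P) (hX : X =ᵐ[P] X') (hY : Y =ᵐ[P] Y') :
    IsStdBivariateNormal X' Y' ρ P where
  gaussian := h.gaussian.congr (hX.prodMk hY)
  mean_fst := by rw [← integral_congr_ae hX, h.mean_fst]
  mean_snd := by rw [← integral_congr_ae hY, h.mean_snd]
  variance_fst := by rw [← variance_congr hX, h.variance_fst]
  variance_snd := by rw [← variance_congr hY, h.variance_snd]
  covariance_eq := by
    rw [← h.covariance_eq, covariance, covariance, integral_congr_ae hX, integral_congr_ae hY]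
    refine integral_congr_ae ?_
    filter_upwards [hX, hY] with ω h1 h2
    rw [h1, h2]

theorem integral_comp_fst (h : IsStdBivariateNormal X Y ρ P) {f : ℝ → ℝ}
    (hf : MemLp f 2 (gaussianReal 0 1)) : ∫ ω, f (X ω) ∂P = hermiteCoeff 0 f := by
  rw [← integral_map h.gaussian.fst.aemeasurable (by rw [h.map_fst]; exact hf.1), h.map_fst]
  simp [hermiteCoeff, normHermite, hermiteFun]

variable [IsProbabilityMeasure P] {f g : ℝ → ℝ}

theorem hasSum_integral_mul_of_measurable (h : IsStdBivariateNormal X Y ρ P)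
    (hX : Measurable X) (hY : Measurable Y) (hf : MemLp f 2 (gaussianReal 0 1))
    (hg : MemLp g 2 (gaussianReal 0 1)) :
    HasSum (fun m => hermiteCoeff m f * hermiteCoeff m g * ρ ^ m)
      (∫ ω, f (X ω) * g (Y ω) ∂P) := by
  have hXp : MeasurePreserving X P (gaussianReal 0 1) := ⟨hX, h.map_fst⟩
  have hYp : MeasurePreserving Y P (gaussianReal 0 1) := ⟨hY, h.map_snd⟩
  let U := (Lp.compMeasurePreservingₗᵢ ℝ (E := ℝ) (p := 2) X hXp).toContinuousLinearMap
  let V := (Lp.compMeasurePreservingₗᵢ ℝ (E := ℝ) (p := 2) Y hYp).toContinuousLinearMap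
  have hUV : ∀ {a b : ℝ → ℝ} (ha : MemLp a 2 (gaussianReal 0 1))
      (hb : MemLp b 2 (gaussianReal 0 1)),
      ⟪U ha.toLp, V hb.toLp⟫_ℝ = ∫ ω, a (X ω) * b (Y ω) ∂P := fun ha hb =>
    inner_toLp_toLp (ha.comp_measurePreserving hXp) (hb.comp_measurePreserving hYp)
  have hbasis : ∀ m n, ⟪U (hermiteLp m), V (hermiteLp n)⟫_ℝ = if m = n then ρ ^ n else 0 :=
    fun m n => by rw [hermiteLp, hermiteLp, hUV, h.integral_normHermite_mul]
  -- Only `g` is expanded here, against a fixed h_m(X), so a single term survives; expanding `f`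
  -- afterwards avoids a double series.
  have hmix : ∀ m, ⟪U (hermiteLp m), V hg.toLp⟫_ℝ = hermiteCoeff m g * ρ ^ m := fun m => by
    have hs := (hermiteBasis_hasSum hg).mapL ((innerSL ℝ (U (hermiteLp m))).comp V)
    simp only [ContinuousLinearMap.comp_apply, map_smul, innerSL_apply_apply, hbasis,
      smul_eq_mul] at hs
    refine hs.unique ?_
    have hsingle := hasSum_single (f := fun n => hermiteCoeff n g * if m = n then ρ ^ n else 0) m
      fun n hn => by simp [hn.symm]
    simpa using hsingle
  have hs := (hermiteBasis_hasSum hf).mapL ((innerSL ℝ (V hg.toLp)).comp U)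
  simpa only [ContinuousLinearMap.comp_apply, map_smul, innerSL_apply_apply, smul_eq_mul,
    real_inner_comm, hmix, hUV, mul_assoc] using hs

/-- The Hermite expansion of the mixed moment `E[f(X) g(Y)]`. -/
theorem hasSum_integral_mul (h : IsStdBivariateNormal X Y ρ P)
    (hf : MemLp f 2 (gaussianReal 0 1)) (hg : MemLp g 2 (gaussianReal 0 1)) :
    HasSum (fun m => hermiteCoeff m f * hermiteCoeff m g * ρ ^ m)
      (∫ ω, f (X ω) * g (Y ω) ∂P) := by
  have hX := h.gaussian.fst.aemeasurable
  have hY := h.gaussian.snd.aemeasurable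
  convert (h.congr hX.ae_eq_mk hY.ae_eq_mk).hasSum_integral_mul_of_measurable
    hX.measurable_mk hY.measurable_mk hf hg using 1
  refine integral_congr_ae ?_
  filter_upwards [hX.ae_eq_mk, hY.ae_eq_mk] with ω h1 h2
  rw [← h1, ← h2]

end IsStdBivariateNormal

end GaussHermite

theorem lemma2 {Ω : Type*} [MeasurableSpace Ω] (P : MeasureTheory.Measure Ω)
    [MeasureTheory.IsProbabilityMeasure P] (X Y : Ω → ℝ) (ρ : ℝ)
    (hXY : GaussHermite.IsStdBivariateNormal X Y ρ P) (g h : ℝ → ℝ)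
    (hg : MeasureTheory.MemLp g 2 (ProbabilityTheory.gaussianReal 0 1))
    (hh : MeasureTheory.MemLp h 2 (ProbabilityTheory.gaussianReal 0 1)) :
    MeasureTheory.MemLp (fun ω => g (X ω)) 2 P ∧
    MeasureTheory.MemLp (fun ω => h (Y ω)) 2 P ∧
    -- the term with index `m` is the term of order `m + 1`, so the sum runs over orders `≥ 1`
    HasSum (fun m : ℕ => GaussHermite.hermiteCoeff (m + 1) g *
        GaussHermite.hermiteCoeff (m + 1) h * ρ ^ (m + 1))
      (ProbabilityTheory.covariance (fun ω => g (X ω)) (fun ω => h (Y ω)) P) := by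
  have hgX := hXY.memLp_comp_fst hg
  have hhY := hXY.memLp_comp_snd hh
  refine ⟨hgX, hhY, ?_⟩
  -- Removing order 0 subtracts the product of the means, since He_0 = 1. `HasSum` in ℝ is
  -- unconditional, which gives absolute convergence.
  have hs := (hasSum_nat_add_iff' 1).2 (hXY.hasSum_integral_mul hg hh)
  rw [covariance_eq_sub hgX hhY, hXY.integral_comp_fst hg, hXY.symm.integral_comp_fst hh]
  simpa using hs
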